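/- **Setting.** All Hilbert spaces are finite-dimensional. A *sub-normalized state* on $\mathcal H$ is a positive semi-definite operator $\rho$ on $\mathcal H$ with $0 < \operatorname{tr}\rho \le 1$; a *normalized state* is one with $\operatorname{tr}\rho = 1$. For a sub-normalized state $\rho_{AB}$ on $\mathcal H_A\otimes\mathcal H_B$, the conditional min-entropy is $$H_{\min}(A|B)_\rho := \max_{\sigma_B}\ \sup\{\lambda\in\mathbb R : 2^{-\lambda}\,\mathbb 1_A\otimes\sigma_B \ge \rho_{AB}\},$$ where $\sigma_B$ ranges over the normalized states on $\mathcal H_B$ (and $\sup\emptyset=-\infty$). The conditional max-entropy is its dual, $$H_{\max}(A|B)_\rho := -H_{\min}(A|C)_\rho,$$ where $\rho_{ABC}=|\psi\rangle\langle\psi|$ is a purification of $\rho_{AB}$, i.e. $\psi\in\mathcal H_A\otimes\mathcal H_B\otimes\mathcal H_C$ with $\operatorname{tr}_C|\psi\rangle\langle\psi|=\rho_{AB}$, and $\rho_{AC}=\operatorname{tr}_B\rho_{ABC}$; the value does not depend on the choice of purification. **Lemma (Concavity of the max-entropy).** Let $\{p_i\}_i$ be a finite probability distribution, let $\{\rho^i_{AB}\}_i$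 be sub-normalized states on $\mathcal H_A\otimes\mathcal H_B$, and let $\tau_{AB} := \sum_i p_i\,\rho^i_{AB}$. Then $$H_{\max}(A|B)_\tau \ \ge\ \sum_i p_i\, H_{\max}(A|B)_{\rho^i}.$$ -/

import Mathlib

open scoped ComplexOrder MatrixOrder Kronecker

/-! Finite-dimensional Hilbert spaces `ℋ_A`, `ℋ_B`, `ℋ_C` are represented by orthonormal bases
indexed by finite types `A`, `B`, `C`; operators on `ℋ_A` are complex matrices indexed by `A`,
and `ℋ_A ⊗ ℋ_B` has the product basis indexed by `A × B`.  The order `≤` on matrices is the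
Loewner order (`M ≤ N` iff `N - M` is positive semi-definite). -/

namespace QState

/-- Normalized states: positive semi-definite operators of trace one. -/
def IsNormalized {H : Type*} [Fintype H] (ρ : Matrix H H ℂ) : Prop :=
  ρ.PosSemidef ∧ ρ.trace = 1

/-- Sub-normalized states: positive semi-definite operators with `0 < tr ρ ≤ 1`. -/
def IsSubnormalized {H : Type*} [Fintype H] (ρ : Matrix H H ℂ) : Prop :=
  ρ.PosSemidef ∧ 0 < ρ.trace.re ∧ ρ.trace.re ≤ 1

/-- The operator `|ψ⟩⟨ψ|`. -/
def pureState {H : Type*} (ψ : H → ℂ) : Matrix H H ℂ :=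
  Matrix.vecMulVec ψ (star ψ)

/-- The partial trace over `C`, from operators on `ℋ_H ⊗ ℋ_C` to operators on `ℋ_H`. -/
def partialTrace {H C : Type*} [Fintype C] (M : Matrix (H × C) (H × C) ℂ) : Matrix H H ℂ :=
  Matrix.of fun x y => ∑ c, M (x, c) (y, c)

/-- The marginal on `AC` of an operator on `ABC`, that is, its partial trace over `B`. -/
def marginalAC {A B C : Type*} [Fintype B] (M : Matrix ((A × B) × C) ((A × B) × C) ℂ) :
    Matrix (A × C) (A × C) ℂ :=
  Matrix.of fun x y => ∑ b, M ((x.1, b), x.2) ((y.1, b), y.2)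

/-- The vector `ψ ∈ ℋ_H ⊗ ℋ_C` is a purification of `ρ`: `tr_C |ψ⟩⟨ψ| = ρ`. -/
def IsPurification {H C : Type*} [Fintype C] (ψ : H × C → ℂ) (ρ : Matrix H H ℂ) : Prop :=
  partialTrace (pureState ψ) = ρ

/-- The real numbers `l` such that `2 ^ (-l) • (1_A ⊗ σ_B) ≥ ρ_AB` for some normalized state
`σ_B` on `B`. -/
def minEntropySet {A B : Type*} [Fintype B] [DecidableEq A]
    (ρ : Matrix (A × B) (A × B) ℂ) : Set ℝ :=
  {l : ℝ | ∃ σ : Matrix B B ℂ, IsNormalized σ ∧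
    ρ ≤ ((2 : ℝ) ^ (-l)) • ((1 : Matrix A A ℂ) ⊗ₖ σ)}

/-- The conditional min-entropy `H_min(A|B)_ρ`,
`max_σ sup {l : ℝ | 2 ^ (-l) • (1_A ⊗ σ_B) ≥ ρ_AB}` over the normalized states `σ_B`.
The two suprema are taken at once; in this way states `σ_B` that admit no `l` at all
(whose supremum is `-∞`) do not contribute. -/
noncomputable def minEntropy {A B : Type*} [Fintype B] [DecidableEq A]
    (ρ : Matrix (A × B) (A × B) ℂ) : ℝ :=
  sSup (minEntropySet ρ)

/-- A purification of a positive semi-definite `ρ` on `ℋ_H ⊗ ℋ_H`, namely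
`(√ρ ⊗ 1) ∑ x, |x⟩ ⊗ |x⟩`. -/
noncomputable def canonicalPurification {H : Type*} [Fintype H] [DecidableEq H]
    (ρ : Matrix H H ℂ) : H × H → ℂ :=
  fun x => CFC.sqrt ρ x.1 x.2

/-- The conditional max-entropy `H_max(A|B)_ρ := - H_min(A|C)_ρ`, where `ρ_ABC` is a
purification of `ρ_AB`.  It does not depend on the purification: see
`maxEntropy_eq_of_isPurification`. -/
noncomputable def maxEntropy {A B : Type*} [Fintype A] [Fintype B] [DecidableEq A] [DecidableEq B]
    (ρ : Matrix (A × B) (A × B) ℂ) : ℝ :=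
  - minEntropy (marginalAC (pureState (canonicalPurification ρ)))

/-! ### The definitions make sense -/

theorem isPurification_canonical {H : Type*} [Fintype H] [DecidableEq H]
    {ρ : Matrix H H ℂ} (hρ : ρ.PosSemidef) : IsPurification (canonicalPurification ρ) ρ := by
  have h0 : (0 : Matrix H H ℂ) ≤ ρ := hρ.nonneg
  have h1 : (CFC.sqrt ρ).IsHermitian := (Matrix.nonneg_iff_posSemidef.mp (CFC.sqrt_nonneg ρ)).1
  have h2 : CFC.sqrt ρ * CFC.sqrt ρ = ρ := CFC.sqrt_mul_sqrt_self ρ h0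
  unfold IsPurification
  ext x y
  conv_rhs => rw [← h2]
  simp only [partialTrace, pureState, canonicalPurification, Matrix.vecMulVec_apply,
    Matrix.of_apply, Matrix.mul_apply, Pi.star_apply]
  refine Finset.sum_congr rfl fun c _ => ?_
  rw [h1.apply]

/-- Two families of vectors with the same Gram matrix are related by a contraction. -/
theorem exists_contraction {m C D : Type*} [Fintype m] [Fintype C] [Fintype D]
    [DecidableEq m] [DecidableEq C] (X : Matrix C m ℂ) (Y : Matrix D m ℂ)
    (h : X.conjTranspose * X = Y.conjTranspose * Y) :
    ∃ U : Matrix D C ℂ, U * X = Y ∧ (1 - U.conjTranspose * U).PosSemidef := by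
  set G := X.conjTranspose * X with hG
  have hGh : G.IsHermitian := Matrix.isHermitian_conjTranspose_mul_self X
  have hGs : IsSelfAdjoint G := hGh
  have hc : ∀ f : ℝ → ℝ, ContinuousOn f (spectrum ℝ G) := fun f =>
    (Matrix.finite_real_spectrum (A := G)).continuousOn f
  set R := cfc (fun x : ℝ => x⁻¹) G with hR
  have hRh : R.conjTranspose = R := by
    have : IsSelfAdjoint R := cfc_predicate _ _
    exact this
  have hid : cfc (fun x : ℝ => x) G = G := cfc_id' ℝ G
  have hRG : R * G = cfc (fun x : ℝ => x⁻¹ * x) G := by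
    rw [cfc_mul _ _ G (hc _) (hc _), hid]
  have hGRG : G * (R * G) = G := by
    rw [hRG]
    conv_lhs => enter [1]; rw [← hid]
    rw [← cfc_mul _ _ G (hc _) (hc _)]
    conv_rhs => rw [← hid]
    congr 1
    funext x
    by_cases hx : x = 0
    · simp [hx]
    · field_simp
  have hRGR : R * G * R = R := by
    rw [hRG, hR, ← cfc_mul _ _ G (hc _) (hc _)]
    congr 1
    funext x
    by_cases hx : x = 0
    · simp [hx]
    · field_simp
  have hU : (Y * R * X.conjTranspose).conjTranspose * (Y * R * X.conjTranspose)
      = X * R * X.conjTranspose := by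
    have : (Y * R * X.conjTranspose).conjTranspose * (Y * R * X.conjTranspose)
        = X * (R * (Y.conjTranspose * Y) * R) * X.conjTranspose := by
      simp only [Matrix.conjTranspose_mul, Matrix.conjTranspose_conjTranspose, hRh,
        Matrix.mul_assoc]
    rw [this, ← h, hRGR]
  refine ⟨Y * R * X.conjTranspose, ?_, ?_⟩
  · have h1 : Y * R * X.conjTranspose * X = Y * (R * G) := by
      simp only [hG, Matrix.mul_assoc]
    rw [h1]
    have h2 : (Y * (R * G) - Y).conjTranspose * (Y * (R * G) - Y) = 0 := by
      have e1 : Y * (R * G) - Y = Y * (R * G - 1) := by rw [Matrix.mul_sub, Matrix.mul_one]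
      rw [e1, Matrix.conjTranspose_mul, Matrix.mul_assoc, ← Matrix.mul_assoc Y.conjTranspose, ← h,
        Matrix.mul_sub, hGRG, Matrix.mul_one, sub_self, Matrix.mul_zero]
    exact sub_eq_zero.mp (Matrix.conjTranspose_mul_self_eq_zero.mp h2)
  · rw [hU]
    set Q := X * R * X.conjTranspose with hQ
    have hQh : Q.conjTranspose = Q := by
      simp only [hQ, Matrix.conjTranspose_mul, Matrix.conjTranspose_conjTranspose, hRh,
        Matrix.mul_assoc]
    have hQQ : Q * Q = Q := by
      have : Q * Q = X * (R * G * R) * X.conjTranspose := by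
        simp only [hQ, hG, Matrix.mul_assoc]
      rw [this, hRGR]
    have : 1 - Q = (1 - Q).conjTranspose * (1 - Q) := by
      rw [Matrix.conjTranspose_sub, hQh, Matrix.conjTranspose_one, Matrix.mul_sub, Matrix.sub_mul,
        Matrix.sub_mul, hQQ]
      simp
    rw [this]
    exact Matrix.posSemidef_conjTranspose_mul_self _

theorem minEntropySet_subset {A B C D : Type*} [Fintype A] [Fintype B] [Fintype C] [Fintype D]
    [DecidableEq A] [Nonempty D] (ψ : (A × B) × C → ℂ) (φ : (A × B) × D → ℂ)
    (h : partialTrace (pureState ψ) = partialTrace (pureState φ)) :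
    minEntropySet (marginalAC (pureState ψ)) ⊆ minEntropySet (marginalAC (pureState φ)) := by
  classical
  rintro l ⟨σ, ⟨hσ, hσ1⟩, hle⟩
  obtain ⟨U, hUX, hU⟩ := exists_contraction (Matrix.of fun c x => ψ (x, c))
    (Matrix.of fun d x => φ (x, d)) (by
      ext x y
      have := congrFun (congrFun h y) x
      simp only [partialTrace, pureState, Matrix.of_apply, Matrix.vecMulVec_apply,
        Pi.star_apply] at this
      simp only [Matrix.mul_apply, Matrix.conjTranspose_apply, Matrix.of_apply]
      simpa only [mul_comm] using this)
  have hφ : ∀ x d, φ (x, d) = ∑ c, U d c * ψ (x, c) := fun x d => by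
    have := congrFun (congrFun hUX d) x
    simpa [Matrix.mul_apply] using this.symm
  set K : Matrix (A × D) (A × C) ℂ := (1 : Matrix A A ℂ) ⊗ₖ U with hK
  have hmarg : marginalAC (pureState φ)
      = K * marginalAC (pureState ψ) * K.conjTranspose := by
    ext ⟨a, d⟩ ⟨a', d'⟩
    simp only [marginalAC, pureState, Matrix.of_apply, Matrix.vecMulVec_apply, Pi.star_apply,
      hK, Matrix.mul_apply, Matrix.conjTranspose_apply, Matrix.kroneckerMap_apply,
      Fintype.sum_prod_type, Matrix.one_apply, hφ, star_sum, star_mul']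
    simp only [ite_mul, one_mul, zero_mul, Finset.sum_ite_irrel, Finset.sum_const_zero,
      Finset.sum_ite_eq, Finset.mem_univ, if_true, apply_ite star, star_one, star_zero,
      mul_ite, mul_zero, Finset.mul_sum, Finset.sum_mul]
    rw [Finset.sum_comm]
    refine Finset.sum_congr rfl fun c _ => ?_
    rw [Finset.sum_comm]
    refine Finset.sum_congr rfl fun c' _ => Finset.sum_congr rfl fun b _ => ?_
    ring
  set σ₀ := U * σ * U.conjTranspose with hσ₀
  have hσ₀p : σ₀.PosSemidef := hσ.mul_mul_conjTranspose_same U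
  have hσ₀t : σ₀.trace ≤ 1 := by
    have hpos : (0 : ℂ) ≤ ((CFC.sqrt σ) * (1 - U.conjTranspose * U) *
        (CFC.sqrt σ).conjTranspose).trace :=
      (hU.mul_mul_conjTranspose_same _).trace_nonneg
    have h1 : (CFC.sqrt σ).conjTranspose = CFC.sqrt σ := (Matrix.nonneg_iff_posSemidef.mp (CFC.sqrt_nonneg σ)).1
    have h2 : CFC.sqrt σ * CFC.sqrt σ = σ := CFC.sqrt_mul_sqrt_self σ hσ.nonneg
    rw [h1, Matrix.trace_mul_comm, ← Matrix.mul_assoc, h2, Matrix.mul_sub, Matrix.trace_sub,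
      Matrix.mul_one, hσ1, ← Matrix.mul_assoc, Matrix.trace_mul_comm, ← Matrix.mul_assoc] at hpos
    exact sub_nonneg.mp hpos
  set e : ℂ := (1 - σ₀.trace) * (Fintype.card D : ℂ)⁻¹ with he
  have hcard : (0 : ℂ) < (Fintype.card D : ℂ) := by exact_mod_cast Fintype.card_pos
  have he0 : 0 ≤ e := by
    refine mul_nonneg (sub_nonneg.mpr hσ₀t) ?_
    have : (0 : ℝ) ≤ (Fintype.card D : ℝ)⁻¹ := by positivity
    have := Complex.zero_le_real.mpr this
    push_cast at this
    exact this
  have hep : (e • (1 : Matrix D D ℂ)).PosSemidef := Matrix.PosSemidef.one.smul he0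
  refine ⟨σ₀ + e • (1 : Matrix D D ℂ), ⟨hσ₀p.add hep, ?_⟩, ?_⟩
  · rw [Matrix.trace_add, Matrix.trace_smul, Matrix.trace_one, smul_eq_mul, he, mul_assoc,
      inv_mul_cancel₀ hcard.ne']
    ring
  · rw [Matrix.le_iff] at hle ⊢
    have h1 := hle.mul_mul_conjTranspose_same K
    have h2 : K * ((1 : Matrix A A ℂ) ⊗ₖ σ) * K.conjTranspose = (1 : Matrix A A ℂ) ⊗ₖ σ₀ := by
      rw [hK, Matrix.conjTranspose_kronecker, ← Matrix.mul_kronecker_mul,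
        ← Matrix.mul_kronecker_mul]
      simp [hσ₀]
    rw [Matrix.mul_sub, Matrix.sub_mul, ← hmarg, Matrix.mul_smul, Matrix.smul_mul, h2] at h1
    have h3 : ((1 : Matrix A A ℂ) ⊗ₖ (e • (1 : Matrix D D ℂ))).PosSemidef :=
      Matrix.PosSemidef.one.kronecker hep
    have h4 := h3.smul (show (0 : ℝ) ≤ (2 : ℝ) ^ (-l) by positivity)
    have h5 := h1.add h4
    rw [Matrix.kronecker_add, smul_add]
    convert h5 using 1
    abel

/-- Every purification of a non-zero positive semi-definite `ρ_AB`, on any purifying space,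
gives the same max-entropy. -/
theorem maxEntropy_eq_of_isPurification {A B C : Type*} [Fintype A] [Fintype B] [Fintype C]
    [DecidableEq A] [DecidableEq B] {ρ : Matrix (A × B) (A × B) ℂ}
    (hρ : ρ.PosSemidef) (hρ0 : 0 < ρ.trace.re) {ψ : (A × B) × C → ℂ} (hψ : IsPurification ψ ρ) :
    maxEntropy ρ = - minEntropy (marginalAC (pureState ψ)) := by
  have hc := isPurification_canonical hρ
  have hne : Nonempty (A × B) := by
    by_contra hn
    rw [not_nonempty_iff] at hn
    simp [Matrix.trace] at hρ0
  have hC : Nonempty C := by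
    by_contra hn
    rw [not_nonempty_iff] at hn
    rw [← hψ] at hρ0
    simp [Matrix.trace, partialTrace] at hρ0
  unfold maxEntropy minEntropy
  congr 2
  exact (minEntropySet_subset _ _ (hc.trans hψ.symm)).antisymm
    (minEntropySet_subset _ _ (hψ.trans hc.symm))

/-- For a sub-normalized state the supremum that defines the min-entropy is one of a non-empty
set that is bounded above. -/
theorem isLUB_minEntropy {A B : Type*} [Fintype A] [Fintype B] [DecidableEq A]
    {ρ : Matrix (A × B) (A × B) ℂ} (hρ : IsSubnormalized ρ) :
    IsLUB (minEntropySet ρ) (minEntropy ρ) := by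
  classical
  obtain ⟨hp, h0, h1⟩ := hρ
  have hne : Nonempty (A × B) := by
    by_contra hn
    rw [not_nonempty_iff] at hn
    simp [Matrix.trace] at h0
  have hA : Nonempty A := ⟨hne.some.1⟩
  have hB : Nonempty B := ⟨hne.some.2⟩
  have hdA : (0 : ℝ) < Fintype.card A := by exact_mod_cast Fintype.card_pos
  have hdB : (0 : ℝ) < Fintype.card B := by exact_mod_cast Fintype.card_pos
  refine isLUB_csSup ?_ ?_
  · obtain ⟨M, hM0, hM⟩ : ∃ M : ℝ, 0 < M ∧ ρ ≤ M • (1 : Matrix (A × B) (A × B) ℂ) := by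
      obtain ⟨M, hM⟩ := (Set.finite_range hp.1.eigenvalues).bddAbove
      refine ⟨max M 1, by positivity, ?_⟩
      have := le_algebraMap_of_spectrum_le (R := ℝ) (a := ρ) (r := max M 1) (by
        intro x hx
        rw [hp.1.spectrum_real_eq_range_eigenvalues] at hx
        exact (hM hx).trans (le_max_left _ _)) hp.1
      rwa [Algebra.algebraMap_eq_smul_one] at this
    have hMd : 0 < M * Fintype.card B := by positivity
    refine ⟨- Real.logb 2 (M * Fintype.card B), ((Fintype.card B : ℝ)⁻¹) • (1 : Matrix B B ℂ),
      ⟨Matrix.PosSemidef.one.smul (by positivity), ?_⟩, ?_⟩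
    · rw [Matrix.trace_smul, Matrix.trace_one, Complex.real_smul]
      push_cast
      exact inv_mul_cancel₀ (by exact_mod_cast hdB.ne')
    · rw [neg_neg, Real.rpow_logb (by norm_num) (by norm_num) hMd, Matrix.kronecker_smul,
        Matrix.one_kronecker_one, smul_smul, mul_assoc, mul_inv_cancel₀ hdB.ne', mul_one]
      exact hM
  · refine ⟨- Real.logb 2 (ρ.trace.re / Fintype.card A), ?_⟩
    rintro l ⟨σ, ⟨_, hσ1⟩, hle⟩
    rw [Matrix.le_iff] at hle
    have ht := (Complex.le_def.mp hle.trace_nonneg).1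
    rw [Matrix.trace_sub, Matrix.trace_smul, Matrix.trace_kronecker, hσ1, Matrix.trace_one,
      mul_one, Complex.real_smul, Complex.sub_re, Complex.re_ofReal_mul, Complex.zero_re,
      Complex.natCast_re, sub_nonneg, ← div_le_iff₀ hdA] at ht
    have := (Real.logb_le_iff_le_rpow (b := 2) (by norm_num) (by positivity)).mpr ht
    linarith

end QState

namespace QState

/-! By duality the claim is an upper bound on a min-entropy. Purify the mixture with a flag register
kept on the purifying side: `∑ i, √(p i) ψ i ⊗ |i⟩`. Let `σ` on `ι × C` be feasible with exponent
`l`. Its diagonal block at flag `i`, of trace `q i`, dominates the corresponding block of the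
marginal, which is `p i` times the marginal of `ψ i`. When `p i > 0`, normalizing that block shows
that the `i`-th min-entropy is at least `l - log₂ (q i / p i)`. Averaging over `p` costs only the
relative entropy of `p` and `q`, which has the favourable sign (Gibbs' inequality). This is
`le_sum_minEntropy_of_mem_minEntropySet`; independence of the purification transfers it to the
max-entropy. -/

theorem isSubnormalized_marginalAC {A B C : Type*} [Fintype A] [Fintype B]
    [Fintype C] {ψ : (A × B) × C → ℂ}
    (h : IsSubnormalized (partialTrace (pureState ψ))) :
    IsSubnormalized (marginalAC (pureState ψ)) := by
  have htr : (marginalAC (pureState ψ)).trace = (partialTrace (pureState ψ)).trace := by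
    simp only [Matrix.trace, Matrix.diag_apply, marginalAC, partialTrace, Matrix.of_apply,
      Fintype.sum_prod_type]
    exact Finset.sum_congr rfl fun a _ => Finset.sum_comm
  refine ⟨?_, by rw [htr]; exact h.2.1, by rw [htr]; exact h.2.2⟩
  have hsum : marginalAC (pureState ψ) =
      ∑ b, pureState (fun x : A × C => ψ ((x.1, b), x.2)) := by
    ext x y
    simp [marginalAC, pureState, Matrix.sum_apply, Matrix.vecMulVec_apply]
  rw [hsum]
  exact Matrix.posSemidef_sum _ fun b _ => Matrix.posSemidef_vecMulVec_self_star _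

/-- A feasible operator `σ` on `B` that need not be normalized gives a lower bound on the
min-entropy, and its trace cannot vanish. -/
theorem neg_logb_trace_le_minEntropy {A B : Type*} [Fintype A] [Fintype B] [DecidableEq A]
    {ρ : Matrix (A × B) (A × B) ℂ} (hρ : IsSubnormalized ρ) {σ : Matrix B B ℂ}
    (hσ : σ.PosSemidef) (hle : ρ ≤ (1 : Matrix A A ℂ) ⊗ₖ σ) :
    0 < σ.trace.re ∧ - Real.logb 2 σ.trace.re ≤ minEntropy ρ := by
  have hσ0 := Complex.le_def.mp hσ.trace_nonneg
  have htr : σ.trace = (σ.trace.re : ℂ) := Complex.ext rfl (by simpa using hσ0.2.symm)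
  have hpos : 0 < σ.trace.re := by
    -- With `tr σ = 0`, taking traces in `hle` would force `tr ρ ≤ 0`.
    refine lt_of_le_of_ne hσ0.1 fun h0 => ?_
    have ht := (Complex.le_def.mp (Matrix.le_iff.mp hle).trace_nonneg).1
    rw [Matrix.trace_sub, Matrix.trace_kronecker, htr, ← h0] at ht
    simp only [Complex.zero_re, Complex.ofReal_zero, mul_zero, zero_sub, Complex.neg_re] at ht
    linarith [hρ.2.1]
  -- At `l = -log₂ (tr σ)` the factor `2 ^ (-l) = tr σ` undoes the normalization of `σ`.
  refine ⟨hpos, (isLUB_minEntropy hρ).1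
    ⟨(σ.trace.re)⁻¹ • σ, ⟨hσ.smul (inv_nonneg.mpr hpos.le), ?_⟩, ?_⟩⟩
  · rw [Matrix.trace_smul, htr, Complex.real_smul, Complex.ofReal_re, ← Complex.ofReal_mul,
      inv_mul_cancel₀ hpos.ne', Complex.ofReal_one]
  · rwa [neg_neg, Real.rpow_logb (by norm_num) (by norm_num) hpos, Matrix.kronecker_smul,
      smul_smul, mul_inv_cancel₀ hpos.ne', one_smul]

/-- The vector `∑ i, √(p i) ψ i ⊗ |i⟩`. -/
noncomputable def mixturePurification {ι H C : Type*} (p : ι → ℝ) (ψ : ι → H × C → ℂ) :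
    H × (ι × C) → ℂ :=
  fun x => (√(p x.2.1) : ℂ) * ψ x.2.1 (x.1, x.2.2)

/-- The flag is traced out together with `C`, which kills the cross terms between different `i`. -/
theorem isPurification_mixturePurification {ι H C : Type*} [Fintype ι] [Fintype C]
    {p : ι → ℝ} (hp : ∀ i, 0 ≤ p i) {ψ : ι → H × C → ℂ} {ρ : ι → Matrix H H ℂ}
    (h : ∀ i, IsPurification (ψ i) (ρ i)) :
    IsPurification (mixturePurification p ψ) (∑ i, p i • ρ i) := by
  ext x y
  rw [Matrix.sum_apply]
  simp only [partialTrace, Matrix.of_apply, Fintype.sum_prod_type]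
  refine Finset.sum_congr rfl fun i _ => ?_
  rw [Matrix.smul_apply, ← h i, partialTrace, Matrix.of_apply, Finset.smul_sum]
  refine Finset.sum_congr rfl fun c _ => ?_
  have hs : (√(p i) : ℂ) * √(p i) = p i := by
    rw [← Complex.ofReal_mul, Real.mul_self_sqrt (hp i)]
  simp only [pureState, Matrix.vecMulVec_apply, mixturePurification, Pi.star_apply, star_mul',
    Complex.star_def, Complex.conj_ofReal, Complex.real_smul]
  rw [← hs]
  ring

/-- The flag survives in this marginal, so coherences between different `i` remain, but only in
off-diagonal blocks; compressing to flag `i` discards them. -/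
theorem marginalAC_mixturePurification_submatrix {ι A B C : Type*} [Fintype B]
    {p : ι → ℝ} (hp : ∀ i, 0 ≤ p i) (ψ : ι → (A × B) × C → ℂ) (i : ι) :
    (marginalAC (pureState (mixturePurification p ψ))).submatrix
      (Prod.map id (Prod.mk i)) (Prod.map id (Prod.mk i)) =
      p i • marginalAC (pureState (ψ i)) := by
  ext x y
  have hs : (√(p i) : ℂ) * √(p i) = p i := by
    rw [← Complex.ofReal_mul, Real.mul_self_sqrt (hp i)]
  simp only [Matrix.submatrix_apply, Matrix.smul_apply, marginalAC, Matrix.of_apply,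
    Finset.smul_sum, pureState, Matrix.vecMulVec_apply, mixturePurification, Pi.star_apply,
    star_mul', Complex.star_def, Complex.conj_ofReal, Complex.real_smul, Prod.map, id]
  refine Finset.sum_congr rfl fun b _ => ?_
  rw [← hs]
  ring

theorem isSubnormalized_mixture {ι H : Type*} [Fintype ι] [Fintype H] {p : ι → ℝ}
    (hp : ∀ i, 0 ≤ p i) (hp1 : ∑ i, p i = 1) {ρ : ι → Matrix H H ℂ}
    (hρ : ∀ i, IsSubnormalized (ρ i)) : IsSubnormalized (∑ i, p i • ρ i) := by
  have htr : (∑ i, p i • ρ i).trace.re = ∑ i, p i * (ρ i).trace.re := by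
    rw [Matrix.trace_sum, Complex.re_sum]
    exact Finset.sum_congr rfl fun i _ => by
      rw [Matrix.trace_smul, Complex.real_smul, Complex.re_ofReal_mul]
  refine ⟨Matrix.posSemidef_sum _ fun i _ => (hρ i).1.smul (hp i), ?_, ?_⟩ <;> rw [htr]
  · obtain ⟨i, -, hi⟩ : ∃ i ∈ Finset.univ, 0 < p i :=
      Finset.exists_lt_of_sum_lt (by rw [hp1]; simp)
    exact Finset.sum_pos' (fun j _ => mul_nonneg (hp j) (hρ j).2.1.le)
      ⟨i, Finset.mem_univ i, mul_pos hi (hρ i).2.1⟩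
  · rw [← hp1]
    exact Finset.sum_le_sum fun i _ => mul_le_of_le_one_right (hp i) (hρ i).2.2

/-- The min-entropy of a marginal of `∑ i, √(p i) ψ i ⊗ |i⟩` is at most the average of the
min-entropies of the marginals of the `ψ i`. -/
theorem le_sum_minEntropy_of_mem_minEntropySet {ι A B C : Type*} [Fintype ι] [Fintype A]
    [Fintype B] [Fintype C] [DecidableEq A] {p : ι → ℝ} (hp : ∀ i, 0 ≤ p i)
    (hp1 : ∑ i, p i = 1) {ψ : ι → (A × B) × C → ℂ}
    (hψ : ∀ i, IsSubnormalized (marginalAC (pureState (ψ i)))) {l : ℝ}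
    (hl : l ∈ minEntropySet (marginalAC (pureState (mixturePurification p ψ)))) :
    l ≤ ∑ i, p i * minEntropy (marginalAC (pureState (ψ i))) := by
  obtain ⟨σ, ⟨hσ, hσ1⟩, hle⟩ := hl
  -- The diagonal blocks of `σ`; their traces `q i` form a probability distribution.
  set s : ι → Matrix C C ℂ := fun i => σ.submatrix (Prod.mk i) (Prod.mk i) with hs
  have hsp : ∀ i, (s i).PosSemidef := fun i => hσ.submatrix _
  have hs0 : ∀ i, 0 ≤ (s i).trace.re := fun i => (Complex.le_def.mp (hsp i).trace_nonneg).1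
  have hs1 : ∑ i, (s i).trace.re = 1 := by
    rw [← Complex.re_sum, ← Complex.one_re, ← hσ1]
    simp only [Matrix.trace, Matrix.diag_apply, Fintype.sum_prod_type, hs, Matrix.submatrix_apply]
  have hlog : 0 < Real.log 2 := Real.log_pos one_lt_two
  -- Gibbs' inequality in termwise form: the errors `q i - p i` sum to zero, and the bound also
  -- makes sense when `p i = 0`.
  have key : ∀ i, p i * l ≤ p i * minEntropy (marginalAC (pureState (ψ i))) +
      ((s i).trace.re - p i) / Real.log 2 := by
    intro i
    rcases (hp i).eq_or_lt with h0 | h0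
    · rw [← h0]
      simpa using div_nonneg (hs0 i) hlog.le
    set c : ℝ := (p i)⁻¹ * 2 ^ (-l) with hc
    have hc0 : 0 < c := by positivity
    have hcomp : marginalAC (pureState (ψ i)) ≤ (1 : Matrix A A ℂ) ⊗ₖ (c • s i) := by
      have h1 := ((Matrix.le_iff.mp hle).submatrix
        (Prod.map id (Prod.mk i) : A × C → A × (ι × C))).smul (inv_nonneg.mpr h0.le)
      rw [Matrix.submatrix_sub, Pi.sub_apply, Pi.sub_apply,
        marginalAC_mixturePurification_submatrix hp, smul_sub, smul_smul,
        inv_mul_cancel₀ h0.ne', one_smul] at h1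
      rw [Matrix.le_iff]
      convert h1 using 2
      ext x y
      simp only [Matrix.kroneckerMap_apply, Matrix.smul_apply, Matrix.submatrix_apply, Prod.map,
        id, hc, hs, Complex.real_smul]
      push_cast
      ring
    obtain ⟨h2, h3⟩ := neg_logb_trace_le_minEntropy (hψ i) ((hsp i).smul hc0.le) hcomp
    rw [Matrix.trace_smul, Complex.real_smul, Complex.re_ofReal_mul] at h2 h3
    -- `p i > 0` forces `q i > 0`, so the logarithm of `q i / p i` can be split off.
    have hq : 0 < (s i).trace.re := pos_of_mul_pos_right h2 hc0.le
    have h4 : c * (s i).trace.re = 2 ^ (-l) * ((s i).trace.re / p i) := by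
      rw [hc]
      ring
    rw [h4, Real.logb_mul (by positivity) (by positivity),
      Real.logb_rpow (by norm_num) (by norm_num)] at h3
    have h5 : Real.logb 2 ((s i).trace.re / p i) ≤ ((s i).trace.re / p i - 1) / Real.log 2 :=
      div_le_div_of_nonneg_right (Real.log_le_sub_one_of_pos (by positivity)) hlog.le
    have h6 : p i * (((s i).trace.re / p i - 1) / Real.log 2) =
        ((s i).trace.re - p i) / Real.log 2 := by
      field_simp
    rw [← h6, ← mul_add]
    exact mul_le_mul_of_nonneg_left (by linarith) h0.le
  have hsum := Finset.sum_le_sum fun i (_ : i ∈ Finset.univ) => key i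
  rwa [← Finset.sum_mul, hp1, one_mul, Finset.sum_add_distrib, ← Finset.sum_div,
    Finset.sum_sub_distrib, hs1, hp1, sub_self, zero_div, add_zero] at hsum

end QState

theorem mainTheorem11 {A B ι : Type*} [Fintype A] [Fintype B] [Fintype ι]
    [DecidableEq A] [DecidableEq B]
    (p : ι → ℝ) (hp : ∀ i, 0 ≤ p i) (hp1 : ∑ i, p i = 1)
    (ρ : ι → Matrix (A × B) (A × B) ℂ) (hρ : ∀ i, QState.IsSubnormalized (ρ i))
    (τ : Matrix (A × B) (A × B) ℂ) (hτ : τ = ∑ i, p i • ρ i) :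
    QState.maxEntropy τ ≥ ∑ i, p i * QState.maxEntropy (ρ i) := by
  subst hτ
  have hτs := QState.isSubnormalized_mixture hp hp1 hρ
  -- The canonical purifications all use the same purifying space `A × B`, as the flagged
  -- superposition requires.
  have hψ := fun i => QState.isPurification_canonical (hρ i).1
  have hφ := QState.isPurification_mixturePurification hp hψ
  rw [QState.maxEntropy_eq_of_isPurification hτs.1 hτs.2.1 hφ]
  simp only [QState.maxEntropy, mul_neg, Finset.sum_neg_distrib, ge_iff_le, neg_le_neg_iff]
  have hm := QState.isSubnormalized_marginalAC (hφ.symm ▸ hτs)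
  refine (QState.isLUB_minEntropy hm).2 fun l hl =>
    QState.le_sum_minEntropy_of_mem_minEntropySet hp hp1 (fun i => ?_) hl
  exact QState.isSubnormalized_marginalAC ((hψ i).symm ▸ hρ i)
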